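/- In the Feedback MAB problem there are $n$ independent arms; arm $i$ follows a two-state Markov chain (good $g$, bad $b$) with $\Pr[b\to g]=\alpha_i>0$, $\Pr[g\to b]=\beta_i>0$, $\alpha_i+\beta_i<1$, which evolves whether or not the arm is played. In each step a policy plays at most one arm, chosen (possibly at random) from its past actions and observations; playing arm $i$ reveals its current state and yields $r_i\ge 0$ if that state is good, and $0$ otherwise. The goal is to maximize the infinite horizon average reward $\limsup_{T\to\infty}\frac1T\,\mathbb E[\text{total reward in the first }T\text{ steps}]$; let $\mathrm{POL}$ be its supremum over all policies. Let $v_{it}$ (resp. $u_{it}$) be the probability that arm $i$ is good $t$ steps after it was observed to be bad (resp. good). Whittle's LP, with value $\mathrm{LP}$, is: maximize $\sum_i\sum_{t\ge1} r_i x^i_{gt}$ over $x^i_{st}\ge 0$ ($s\in\{g,b\}$, $t\ge 1$) subject to $$\sum_{i}\sum_{s}\sum_{t\ge1}x^i_{st}=1,\qquad \sum_{s}\sum_{t\ge1}t\,x^i_{st}\le1\ \ \forall i,\qquad \sum_{t\ge1}x^i_{bt}v_{it}=\sum_{t\ge1}x^i_{gt}(1-u_{it})\ \ \forall i.$$ **Theorem.**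 The gap $\mathrm{LP}/\mathrm{POL}$ can be arbitrarily close to $e/(e-1)$. More precisely, for $n\ge2$ and $\beta>0$ with $n\beta<n-1$, consider $n$ identical arms with $\beta_i=\beta$, $\alpha_i=\beta/(n-1)$ and $r_i=1$, with any distribution of the initial joint state. Then: 1. For every $\varepsilon>0$ there are $N$ and $\kappa>0$ such that $\left|\mathrm{LP}/\mathrm{POL}-\frac{e}{e-1}\right|<\varepsilon$ whenever $n\ge N$ and $n\beta<\kappa$. 2. There is an absolute constant $C>0$ such that $1-C\sqrt{n\beta}\le\mathrm{LP}\le1$ for all such $n,\beta$ (so $\mathrm{LP}=1-o(1)$ as $n\beta\to0$). 3. Every policy has average reward at most $1-(1-1/n)^n$, and $\mathrm{POL}>0$. 4. $1-(1-1/n)^n\to1-1/e$ as $n\to\infty$. -/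

import Mathlib

/-- An instance of the Feedback MAB problem with `n` arms. Each arm carries a two-state Markov chain
(`true` is the good state, `false` the bad state) that evolves whether or not the arm is played;
`α i` is the probability of moving from bad to good, `β i` that of moving from good to bad, and
`r i` is the reward of a play in the good state. Since there are finitely many arms, `bursty` says
that `α i + β i ≤ 1 - δ` for all `i` and some `δ > 0`. -/
structure FeedbackMAB (n : ℕ) where
  α : Fin n → ℝ
  β : Fin n → ℝ
  r : Fin n → ℝ
  α_pos : ∀ i, 0 < α i
  β_pos : ∀ i, 0 < β i
  r_nonneg : ∀ i, 0 ≤ r i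
  bursty : ∀ i, α i + β i < 1

namespace FeedbackMAB

variable {n : ℕ}

/-- The one-step transition matrix of arm `i`. -/
def transMatrix (I : FeedbackMAB n) (i : Fin n) : Matrix Bool Bool ℝ :=
  Matrix.of fun s s' =>
    match s, s' with
    | false, true => I.α i
    | false, false => 1 - I.α i
    | true, false => I.β i
    | true, true => 1 - I.β i

/-- `v i t`: probability that arm `i` is good, `t` steps after it was observed in the bad state. -/
noncomputable def v (I : FeedbackMAB n) (i : Fin n) (t : ℕ) : ℝ :=
  (I.transMatrix i ^ t) false true

/-- `u i t`: probability that arm `i` is good, `t` steps after it was observed in the good state. -/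
noncomputable def u (I : FeedbackMAB n) (i : Fin n) (t : ℕ) : ℝ :=
  (I.transMatrix i ^ t) true true

/-! ### Whittle's linear program -/

/-- Feasible solutions `x i s t` (`t ≥ 1`) of Whittle's LP. -/
structure WhittleFeasible (I : FeedbackMAB n) (x : Fin n → Bool → ℕ+ → ℝ) : Prop where
  nonneg : ∀ i s t, 0 ≤ x i s t
  /-- the series below converge (as `t ≥ 1` and `x ≥ 0`, this makes all of them converge) -/
  summable : ∀ i s, Summable fun t : ℕ+ => (t : ℝ) * x i s t
  /-- one play per step on average -/
  plays : ∑ i, ∑ s, ∑' t : ℕ+, x i s t = 1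
  time : ∀ i, ∑ s, ∑' t : ℕ+, (t : ℝ) * x i s t ≤ 1
  balance : ∀ i, ∑' t : ℕ+, x i false t * I.v i t = ∑' t : ℕ+, x i true t * (1 - I.u i t)

/-- The objective of Whittle's LP. -/
noncomputable def whittleObjective (I : FeedbackMAB n) (x : Fin n → Bool → ℕ+ → ℝ) : ℝ :=
  ∑ i, ∑' t : ℕ+, I.r i * x i true t

/-- The objective values of the feasible solutions of Whittle's LP. -/
def whittleValues (I : FeedbackMAB n) : Set ℝ :=
  {w | ∃ x, I.WhittleFeasible x ∧ I.whittleObjective x = w}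

/-- The value of Whittle's LP. -/
noncomputable def whittleOpt (I : FeedbackMAB n) : ℝ := sSup I.whittleValues

/-! ### Policies and their average reward -/

/-- What is recorded in one step: `none` if no arm was played, and `some (i, s)` if arm `i` was
played and observed in state `s`. -/
abbrev Record (n : ℕ) : Type := Option (Fin n × Bool)

/-- A policy: from the list of all past records (the latest one first) it chooses, possibly at
random, an arm to play or (`none`) no arm. -/
abbrev Policy (n : ℕ) : Type := List (Record n) → stdSimplex ℝ (Option (Fin n))

/-- The probability that the joint state moves from `s` to `s'` in one step. -/
noncomputable def jointTrans (I : FeedbackMAB n) (s s' : Fin n → Bool) : ℝ :=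
  ∏ i, I.transMatrix i (s i) (s' i)

/-- The reward of action `a` in the joint state `s`. -/
noncomputable def reward (I : FeedbackMAB n) (a : Option (Fin n)) (s : Fin n → Bool) : ℝ :=
  match a with
  | none => 0
  | some i => if s i = true then I.r i else 0

/-- What is recorded when action `a` is taken in the joint state `s`. -/
def record (a : Option (Fin n)) (s : Fin n → Bool) : Record n :=
  a.map fun i => (i, s i)

/-- The expected total reward of policy `π` in the next `T` steps, when the past records are `h` and
the present (hidden) joint state is `s`. -/
noncomputable def totalReward (I : FeedbackMAB n) (π : Policy n) :
    ℕ → List (Record n) → (Fin n → Bool) → ℝ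
  | 0, _, _ => 0
  | T + 1, h, s => ∑ a, (π h).1 a *
      (I.reward a s + ∑ s', I.jointTrans s s' * totalReward I π T (record a s :: h) s')

/-- The expected average reward per step of `π` in the first `T` steps, from the distribution `μ` of
the initial joint state. -/
noncomputable def averageReward (I : FeedbackMAB n) (μ : stdSimplex ℝ (Fin n → Bool))
    (π : Policy n) (T : ℕ) : ℝ :=
  (∑ s, μ.1 s * I.totalReward π T [] s) / T

/-- The infinite horizon average reward of `π`; the upper limit makes it defined for all policies. -/
noncomputable def longRunReward (I : FeedbackMAB n) (μ : stdSimplex ℝ (Fin n → Bool))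
    (π : Policy n) : ℝ :=
  Filter.limsup (I.averageReward μ π) Filter.atTop

/-- The infinite horizon average reward of an optimal policy. -/
noncomputable def policyOpt (I : FeedbackMAB n) (μ : stdSimplex ℝ (Fin n → Bool)) : ℝ :=
  sSup (Set.range (I.longRunReward μ))

/-- The ratio of the value of Whittle's LP to that of an optimal policy. -/
noncomputable def gap (I : FeedbackMAB n) (μ : stdSimplex ℝ (Fin n → Bool)) : ℝ :=
  I.whittleOpt / I.policyOpt μ

/-- `n` identical arms with parameters `β`, `α = β / (n - 1)` and reward `1`. -/
noncomputable def iid (n : ℕ) (β : ℝ) (hn : 2 ≤ n) (hβ : 0 < β) (h : (n : ℝ) * β < n - 1) :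
    FeedbackMAB n where
  α := fun _ => β / ((n : ℝ) - 1)
  β := fun _ => β
  r := fun _ => 1
  α_pos := fun _ => by
    have h2 : (2 : ℝ) ≤ n := by exact_mod_cast hn
    exact div_pos hβ (by linarith)
  β_pos := fun _ => hβ
  r_nonneg := fun _ => zero_le_one
  bursty := fun _ => by
    have h2 : (2 : ℝ) ≤ n := by exact_mod_cast hn
    have h1 : (0 : ℝ) < (n : ℝ) - 1 := by linarith
    rw [div_add' _ _ _ h1.ne', div_lt_one h1]
    linarith

end FeedbackMAB

/-!
Let `θ = α + β = nβ / (n - 1)`.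

* A solution of the LP replays a good arm at once and a bad arm after `t ≈ √(n / θ)` steps. The
  chance of then finding the bad arm good is of order `t α`, large compared with the chance `β` of
  losing a good arm, so almost all plays find a good arm and the value is `1 - O(√(nβ))`.
* A policy receives in each step at most the indicator of the event that some arm is good. Its mean
  converges to the stationary one, which is `1 - (1 - 1 / n) ^ n`.
* Conversely, if `nβ` is small, then the joint state changes in a stationary step with probability
  at most `2β`. A policy that plays every arm once, stays with an arm it has seen good, and starts
  anew every `n * ⌈1 / √(nβ)⌉` steps therefore loses only `O(√(nβ))` of this bound.
-/

open Filter Topology Matrix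

section Preliminaries

theorem le_limsup_of_tendsto_le_comp {ι κ R : Type*} [ConditionallyCompleteLinearOrder R]
    [TopologicalSpace R] [OrderTopology R] {l : Filter ι} [l.NeBot] {l' : Filter κ} {φ : ι → κ}
    {w : ι → R} {u : κ → R} {c : R} (hφ : Tendsto φ l l') (hw : Tendsto w l (𝓝 c))
    (hwu : ∀ᶠ i in l, w i ≤ u (φ i)) (hu : l'.IsBoundedUnder (· ≤ ·) u) : c ≤ limsup u l' :=
  have hφu : l.IsBoundedUnder (· ≤ ·) (u ∘ φ) :=
    hu.imp fun _ hb => eventually_map.2 (hφ.eventually hb)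
  have hcobdd : l.IsCoboundedUnder (· ≤ ·) (u ∘ φ) :=
    (hw.isBoundedUnder_ge.mono_ge hwu).isCoboundedUnder_le
  calc c = limsup w l := hw.limsup_eq.symm
    _ ≤ limsup (u ∘ φ) l := limsup_le_limsup hwu hw.isCoboundedUnder_le hφu
    _ ≤ limsup u l' := limsup_le_limsup_of_le hφ hcobdd hu

theorem one_sub_sum_le_prod_one_sub {ι : Type*} (s : Finset ι) {f : ι → ℝ}
    (h0 : ∀ i ∈ s, 0 ≤ f i) (h1 : ∀ i ∈ s, f i ≤ 1) :
    1 - ∑ i ∈ s, f i ≤ ∏ i ∈ s, (1 - f i) := by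
  classical
  induction s using Finset.induction_on with
  | empty => simp
  | insert a s ha ih =>
    rw [Finset.forall_mem_insert] at h0 h1
    rw [Finset.sum_insert ha, Finset.prod_insert ha]
    have hsum := Finset.sum_nonneg h0.2
    nlinarith [mul_le_mul_of_nonneg_left (ih h0.2 h1.2) (sub_nonneg.2 h1.1),
      mul_nonneg h0.1 hsum]

theorem div_one_add_le_one_sub_pow {θ : ℝ} (h0 : 0 ≤ θ) (h1 : θ ≤ 1) (t : ℕ) :
    t * θ / (1 + t * θ) ≤ 1 - (1 - θ) ^ t := by
  have bernoulli : 1 + t * θ ≤ (1 + θ) ^ t := one_add_mul_le_pow (by linarith) t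
  have hpow : (1 - θ) ^ t * (1 + t * θ) ≤ 1 := calc
    (1 - θ) ^ t * (1 + t * θ) ≤ (1 - θ) ^ t * (1 + θ) ^ t :=
      mul_le_mul_of_nonneg_left bernoulli (pow_nonneg (by linarith) t)
    _ = (1 - θ ^ 2) ^ t := by rw [← mul_pow]; ring
    _ ≤ 1 := pow_le_one₀ (by nlinarith) (by nlinarith)
  rw [div_le_iff₀ (by positivity)]
  linarith

theorem exists_pnat_sq_le_le_four_mul_sq {y : ℝ} (hy : 1 ≤ y) :
    ∃ t : ℕ+, (t : ℝ) ^ 2 ≤ y ∧ y ≤ 4 * (t : ℝ) ^ 2 := by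
  have hpos : 0 < ⌊√y⌋₊ := Nat.floor_pos.2 (Real.one_le_sqrt.2 hy)
  have hone : (1 : ℝ) ≤ ⌊√y⌋₊ := by exact_mod_cast hpos
  have hlt := Nat.lt_floor_add_one √y
  refine ⟨⟨_, hpos⟩, ?_, ?_⟩ <;> rw [PNat.mk_coe]
  · exact (Real.le_sqrt' (by positivity)).1 (Nat.floor_le (Real.sqrt_nonneg y))
  · calc y ≤ (2 * ⌊√y⌋₊) ^ 2 := (Real.sqrt_le_left (by positivity)).1 (by linarith)
      _ = 4 * (⌊√y⌋₊ : ℝ) ^ 2 := by ring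

theorem hasSum_mul_pi_single {ι R : Type*} [DecidableEq ι] [NonUnitalNonAssocSemiring R]
    [TopologicalSpace R] (f : ι → R) (i : ι) (a : R) :
    HasSum (fun j => f j * (Pi.single i a : ι → R) j) (f i * a) := by
  have h := hasSum_single (f := fun j => f j * (Pi.single i a : ι → R) j) i fun j hj => by
    rw [Pi.single_eq_of_ne hj, mul_zero]
  rwa [Pi.single_eq_same] at h

theorem tsum_mul_pi_single {ι R : Type*} [DecidableEq ι] [NonUnitalNonAssocSemiring R]
    [TopologicalSpace R] [T2Space R] (f : ι → R) (i : ι) (a : R) :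
    ∑' j, f j * (Pi.single i a : ι → R) j = f i * a :=
  (hasSum_mul_pi_single f i a).tsum_eq

end Preliminaries

section TensorMatrix

variable {ι R : Type*} {κ : ι → Type*} [Fintype ι] [CommSemiring R]

theorem prod_dotProduct_prod [DecidableEq ι] [∀ i, Fintype (κ i)] (p f : ∀ i, κ i → R) :
    (fun s : ∀ i, κ i => ∏ i, p i (s i)) ⬝ᵥ (fun s => ∏ i, f i (s i)) = ∏ i, p i ⬝ᵥ f i := by
  simp only [dotProduct, ← Finset.prod_mul_distrib, Fintype.prod_sum]

variable [DecidableEq ι] [∀ i, Fintype (κ i)] [∀ i, DecidableEq (κ i)]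

/-- The tensor product of a finite family of square matrices. If the factors are the transition
matrices of independent Markov chains, it is the transition matrix of the joint chain. -/
def tensorMatrix :
    (∀ i, Matrix (κ i) (κ i) R) →* Matrix (∀ i, κ i) (∀ i, κ i) R where
  toFun M := of fun s s' => ∏ i, M i (s i) (s' i)
  map_one' := by
    ext s s'
    simp [one_apply, Finset.prod_ite_zero, funext_iff]
  map_mul' M N := by
    ext s s'
    exact (prod_dotProduct_prod (fun i => M i (s i)) fun i b => N i b (s' i)).symm

theorem tensorMatrix_apply (M : ∀ i, Matrix (κ i) (κ i) R) (s s' : ∀ i, κ i) :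
    tensorMatrix M s s' = ∏ i, M i (s i) (s' i) := rfl

theorem prod_vecMul_tensorMatrix (p : ∀ i, κ i → R) (M : ∀ i, Matrix (κ i) (κ i) R) :
    (fun s : ∀ i, κ i => ∏ i, p i (s i)) ᵥ* tensorMatrix M = fun s => ∏ i, (p i ᵥ* M i) (s i) :=
  funext fun s => prod_dotProduct_prod p fun i b => M i b (s i)

theorem tensorMatrix_mulVec_prod (M : ∀ i, Matrix (κ i) (κ i) R) (f : ∀ i, κ i → R) :
    tensorMatrix M *ᵥ (fun s : ∀ i, κ i => ∏ i, f i (s i)) = fun s => ∏ i, (M i *ᵥ f i) (s i) :=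
  funext fun s => prod_dotProduct_prod (fun i => M i (s i)) f

theorem tensorMatrix_mem_rowStochastic [PartialOrder R] [IsOrderedRing R]
    {M : ∀ i, Matrix (κ i) (κ i) R} (hM : ∀ i, M i ∈ rowStochastic R (κ i)) :
    tensorMatrix M ∈ rowStochastic R (∀ i, κ i) := by
  refine mem_rowStochastic.2 ⟨fun s s' => Finset.prod_nonneg fun i _ => (hM i).1 _ _, ?_⟩
  have h := tensorMatrix_mulVec_prod M fun _ => 1
  simp only [(hM _).2, Pi.one_apply, Finset.prod_const_one] at h
  exact h

end TensorMatrix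

theorem mulVec_mono_of_mem_rowStochastic {κ R : Type*} [Fintype κ] [DecidableEq κ] [Semiring R]
    [PartialOrder R] [IsOrderedRing R] {M : Matrix κ κ R} (hM : M ∈ rowStochastic R κ) :
    Monotone (M *ᵥ ·) := fun _ _ hfg s =>
  dotProduct_le_dotProduct_of_nonneg_left hfg fun s' => hM.1 s s'

theorem sum_range_succ_pow_mulVec {κ R : Type*} [Fintype κ] [DecidableEq κ] [Semiring R]
    (M : Matrix κ κ R) (f : κ → R) (T : ℕ) :
    ∑ j ∈ Finset.range (T + 1), M ^ j *ᵥ f = f + M *ᵥ ∑ j ∈ Finset.range T, M ^ j *ᵥ f := by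
  simp only [Finset.sum_range_succ', pow_succ', ← mulVec_mulVec, mulVec_sum, pow_zero,
    one_mulVec, add_comm]

namespace FeedbackMAB

variable {n : ℕ}

section Arm

variable (I : FeedbackMAB n) (i : Fin n)

/-- The stationary distribution of the Markov chain of arm `i`. -/
noncomputable def stationary : Bool → ℝ
  | true => I.α i / (I.α i + I.β i)
  | false => I.β i / (I.α i + I.β i)

theorem α_add_β_pos : 0 < I.α i + I.β i :=
  add_pos (I.α_pos i) (I.β_pos i)

theorem stationary_pos (b : Bool) : 0 < I.stationary i b := by
  cases b
  exacts [div_pos (I.β_pos i) (I.α_add_β_pos i), div_pos (I.α_pos i) (I.α_add_β_pos i)]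

theorem sum_stationary : ∑ b, I.stationary i b = 1 := by
  rw [Fintype.sum_bool, stationary, stationary, ← add_div, div_self (I.α_add_β_pos i).ne']

theorem transMatrix_mem_rowStochastic : I.transMatrix i ∈ rowStochastic ℝ Bool := by
  have hα := I.α_pos i
  have hβ := I.β_pos i
  have hαβ := I.bursty i
  refine mem_rowStochastic_iff_sum.2 ⟨fun b b' => ?_, fun b => ?_⟩
  · cases b <;> cases b' <;> simp only [transMatrix, of_apply] <;> linarith
  · cases b <;> simp [transMatrix]

theorem stationary_vecMul_transMatrix : I.stationary i ᵥ* I.transMatrix i = I.stationary i := by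
  have h := (I.α_add_β_pos i).ne'
  ext b
  cases b <;>
    simp only [vecMul, dotProduct, Fintype.sum_bool, stationary, transMatrix, of_apply] <;>
    field_simp <;> ring

theorem transMatrix_pow_apply (t : ℕ) (b b' : Bool) :
    (I.transMatrix i ^ t) b b' = I.stationary i b' +
      (1 - (I.α i + I.β i)) ^ t * ((1 : Matrix Bool Bool ℝ) b b' - I.stationary i b') := by
  have h := (I.α_add_β_pos i).ne'
  induction t generalizing b with
  | zero => simp
  | succ t ih =>
    rw [pow_succ', mul_apply, Fintype.sum_bool, ih, ih, pow_succ]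
    cases b <;> cases b' <;>
      simp only [transMatrix, of_apply, stationary, one_apply, if_true, reduceCtorEq, if_false] <;>
      field_simp <;> ring

theorem tendsto_transMatrix_pow_apply (b b' : Bool) :
    Tendsto (fun t : ℕ => (I.transMatrix i ^ t) b b') atTop (𝓝 (I.stationary i b')) := by
  have hdecay : Tendsto (fun t : ℕ => (1 - (I.α i + I.β i)) ^ t) atTop (𝓝 0) :=
    tendsto_pow_atTop_nhds_zero_of_lt_one (by linarith [I.bursty i]) (by linarith [I.α_add_β_pos i])
  simpa [transMatrix_pow_apply] using (hdecay.mul_const _).const_add (I.stationary i b')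

theorem v_eq (t : ℕ) : I.v i t = I.stationary i true * (1 - (1 - (I.α i + I.β i)) ^ t) := by
  rw [v, transMatrix_pow_apply, one_apply_ne Bool.false_ne_true]
  ring

theorem u_one : I.u i 1 = 1 - I.β i := by
  rw [u, pow_one]
  rfl

theorem div_one_add_le_v (t : ℕ) : t * I.α i / (1 + t * (I.α i + I.β i)) ≤ I.v i t := by
  have hαβ := I.α_add_β_pos i
  calc t * I.α i / (1 + t * (I.α i + I.β i))
      = I.stationary i true * (t * (I.α i + I.β i) / (1 + t * (I.α i + I.β i))) := by
        rw [stationary]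
        field_simp
    _ ≤ I.v i t := by
        rw [v_eq]
        exact mul_le_mul_of_nonneg_left (div_one_add_le_one_sub_pow hαβ.le (I.bursty i).le t)
          (I.stationary_pos i true).le

theorem v_pos {t : ℕ} (ht : 0 < t) : 0 < I.v i t := by
  have hα := I.α_pos i
  have hαβ := I.α_add_β_pos i
  exact lt_of_lt_of_le (by positivity) (I.div_one_add_le_v i t)

end Arm

section JointChain

variable (I : FeedbackMAB n)

/-- The one-step transition matrix of the joint state; its entries are `jointTrans`. -/
noncomputable def jointMatrix : Matrix (Fin n → Bool) (Fin n → Bool) ℝ :=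
  tensorMatrix I.transMatrix

/-- The stationary distribution of the joint state. As a vector it also serves to express
stationary expectations, in the form `I.jointStationary ⬝ᵥ f`. -/
noncomputable def jointStationary (s : Fin n → Bool) : ℝ :=
  ∏ i, I.stationary i (s i)

theorem jointMatrix_mem_rowStochastic : I.jointMatrix ∈ rowStochastic ℝ (Fin n → Bool) :=
  tensorMatrix_mem_rowStochastic I.transMatrix_mem_rowStochastic

theorem jointStationary_pos (s : Fin n → Bool) : 0 < I.jointStationary s :=
  Finset.prod_pos fun i _ => I.stationary_pos i (s i)

theorem jointStationary_dotProduct_prod (f : Fin n → Bool → ℝ) :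
    I.jointStationary ⬝ᵥ (fun s => ∏ i, f i (s i)) = ∏ i, I.stationary i ⬝ᵥ f i :=
  prod_dotProduct_prod I.stationary f

theorem jointStationary_mem_stdSimplex : I.jointStationary ∈ stdSimplex ℝ (Fin n → Bool) := by
  refine ⟨fun s => (I.jointStationary_pos s).le, ?_⟩
  have h := I.jointStationary_dotProduct_prod 1
  simpa only [dotProduct, Pi.one_apply, mul_one, Finset.prod_const_one, sum_stationary] using h

theorem jointStationary_vecMul_pow (t : ℕ) :
    I.jointStationary ᵥ* I.jointMatrix ^ t = I.jointStationary := by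
  induction t with
  | zero => rw [pow_zero, vecMul_one]
  | succ t ih =>
    rw [pow_succ, ← vecMul_vecMul, ih]
    exact (prod_vecMul_tensorMatrix _ _).trans
      (funext fun s => Finset.prod_congr rfl fun i _ => by rw [stationary_vecMul_transMatrix])

theorem jointStationary_dotProduct_pow_mulVec (t : ℕ) (f : (Fin n → Bool) → ℝ) :
    I.jointStationary ⬝ᵥ (I.jointMatrix ^ t *ᵥ f) = I.jointStationary ⬝ᵥ f := by
  rw [dotProduct_mulVec, jointStationary_vecMul_pow]

theorem tendsto_jointMatrix_pow_mulVec (f : (Fin n → Bool) → ℝ) (s : Fin n → Bool) :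
    Tendsto (fun t => (I.jointMatrix ^ t *ᵥ f) s) atTop (𝓝 (I.jointStationary ⬝ᵥ f)) := by
  simp only [jointMatrix, ← map_pow, mulVec, dotProduct, tensorMatrix_apply, Pi.pow_apply]
  exact tendsto_finsetSum _ fun s' _ =>
    (tendsto_finsetProd _ fun i _ => I.tendsto_transMatrix_pow_apply i _ _).mul_const _

theorem tendsto_cesaro_dotProduct_pow_mulVec (μ : stdSimplex ℝ (Fin n → Bool)) {φ : ℕ → ℕ}
    (hφ : Tendsto φ atTop atTop) (f : (Fin n → Bool) → ℝ) :
    Tendsto (fun T : ℕ => μ.1 ⬝ᵥ (∑ j ∈ Finset.range T, I.jointMatrix ^ φ j *ᵥ f) / T) atTop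
      (𝓝 (I.jointStationary ⬝ᵥ f)) := by
  have hlim : Tendsto (fun j => μ.1 ⬝ᵥ (I.jointMatrix ^ φ j *ᵥ f)) atTop
      (𝓝 (I.jointStationary ⬝ᵥ f)) := by
    have h := tendsto_finsetSum Finset.univ fun s _ =>
      ((I.tendsto_jointMatrix_pow_mulVec f s).comp hφ).const_mul (μ.1 s)
    rwa [← Finset.sum_mul, μ.2.2, one_mul] at h
  exact hlim.cesaro.congr fun T => by rw [dotProduct_sum, div_eq_inv_mul]

end JointChain

section Reward

variable (I : FeedbackMAB n)

theorem reward_nonneg (a : Option (Fin n)) : 0 ≤ I.reward a := by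
  intro s
  rcases a with _ | i
  · exact le_rfl
  · exact ite_nonneg (I.r_nonneg i) le_rfl

/-- The highest reward that an action can have in the joint state `s`. -/
noncomputable def maxReward (s : Fin n → Bool) : ℝ :=
  ⨆ a, I.reward a s

theorem reward_le_maxReward (a : Option (Fin n)) : I.reward a ≤ I.maxReward := fun s =>
  le_ciSup (f := fun a => I.reward a s) (Set.finite_range _).bddAbove a

theorem maxReward_nonneg : 0 ≤ I.maxReward :=
  (I.reward_nonneg none).trans (I.reward_le_maxReward none)

/-- An action of highest reward in the joint state `s`. -/
noncomputable def bestAction (s : Fin n → Bool) : Option (Fin n) :=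
  (exists_eq_ciSup_of_finite (f := fun a => I.reward a s)).choose

theorem reward_bestAction (s : Fin n → Bool) : I.reward (I.bestAction s) s = I.maxReward s :=
  (exists_eq_ciSup_of_finite (f := fun a => I.reward a s)).choose_spec

theorem totalReward_succ (π : Policy n) (T : ℕ) (h : List (Record n)) (s : Fin n → Bool) :
    I.totalReward π (T + 1) h s = ∑ a, (π h).1 a *
      (I.reward a s + (I.jointMatrix *ᵥ I.totalReward π T (record a s :: h)) s) := rfl

theorem totalReward_nonneg (π : Policy n) (T : ℕ) (h : List (Record n)) :
    0 ≤ I.totalReward π T h := by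
  induction T generalizing h with
  | zero => exact fun _ => le_rfl
  | succ T ih =>
    intro s
    rw [totalReward_succ]
    refine Finset.sum_nonneg fun a _ => mul_nonneg ((π h).2.1 a)
      (add_nonneg (I.reward_nonneg a s) ?_)
    simpa using mulVec_mono_of_mem_rowStochastic I.jointMatrix_mem_rowStochastic
      (ih (record a s :: h)) s

theorem totalReward_le (π : Policy n) (T : ℕ) (h : List (Record n)) :
    I.totalReward π T h ≤ ∑ j ∈ Finset.range T, I.jointMatrix ^ j *ᵥ I.maxReward := by
  induction T generalizing h with
  | zero => exact fun _ => le_rfl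
  | succ T ih =>
    intro s
    rw [sum_range_succ_pow_mulVec, totalReward_succ, Pi.add_apply]
    refine (Finset.sum_le_sum fun a _ => mul_le_mul_of_nonneg_left (add_le_add
      (I.reward_le_maxReward a s) (mulVec_mono_of_mem_rowStochastic
        I.jointMatrix_mem_rowStochastic (ih _) s)) ((π h).2.1 a)).trans_eq ?_
    rw [← Finset.sum_mul, (π h).2.2, one_mul]

/-- The policy that follows a deterministic rule. -/
noncomputable def deterministic (p : List (Record n) → Option (Fin n)) : Policy n :=
  fun h => ⟨Pi.single (p h) 1, single_mem_stdSimplex ℝ (p h)⟩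

theorem totalReward_deterministic_succ (p : List (Record n) → Option (Fin n)) (T : ℕ)
    (h : List (Record n)) (s : Fin n → Bool) :
    I.totalReward (deterministic p) (T + 1) h s = I.reward (p h) s +
      (I.jointMatrix *ᵥ I.totalReward (deterministic p) T (record (p h) s :: h)) s :=
  single_one_dotProduct (p h) fun a => I.reward a s +
    (I.jointMatrix *ᵥ I.totalReward (deterministic p) T (record a s :: h)) s

theorem totalReward_deterministic_const (a : Option (Fin n)) (T : ℕ) (h : List (Record n)) :
    I.totalReward (deterministic fun _ => a) T h =
      ∑ j ∈ Finset.range T, I.jointMatrix ^ j *ᵥ I.reward a := by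
  induction T generalizing h with
  | zero => rfl
  | succ T ih =>
    ext s
    rw [totalReward_deterministic_succ, ih, sum_range_succ_pow_mulVec, Pi.add_apply]

end Reward

section LongRunReward

variable (I : FeedbackMAB n) (μ : stdSimplex ℝ (Fin n → Bool)) (π : Policy n)

theorem averageReward_nonneg (T : ℕ) : 0 ≤ I.averageReward μ π T :=
  div_nonneg (dotProduct_nonneg_of_nonneg μ.2.1 (I.totalReward_nonneg π T [])) T.cast_nonneg

theorem averageReward_le (T : ℕ) : I.averageReward μ π T ≤
    μ.1 ⬝ᵥ (∑ j ∈ Finset.range T, I.jointMatrix ^ j *ᵥ I.maxReward) / T :=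
  div_le_div_of_nonneg_right
    (dotProduct_le_dotProduct_of_nonneg_left (I.totalReward_le π T []) μ.2.1) T.cast_nonneg

theorem isBoundedUnder_averageReward : IsBoundedUnder (· ≤ ·) atTop (I.averageReward μ π) :=
  (I.tendsto_cesaro_dotProduct_pow_mulVec μ tendsto_id I.maxReward).isBoundedUnder_le.mono_le
    (.of_forall (I.averageReward_le μ π))

theorem longRunReward_le : I.longRunReward μ π ≤ I.jointStationary ⬝ᵥ I.maxReward := by
  have hlim := I.tendsto_cesaro_dotProduct_pow_mulVec μ tendsto_id I.maxReward
  rw [← hlim.limsup_eq]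
  exact limsup_le_limsup (.of_forall (I.averageReward_le μ π))
    (isCoboundedUnder_le_of_le atTop (I.averageReward_nonneg μ π)) hlim.isBoundedUnder_le

theorem isLUB_policyOpt : IsLUB (Set.range (I.longRunReward μ)) (I.policyOpt μ) :=
  isLUB_csSup ⟨_, deterministic fun _ => none, rfl⟩
    ⟨_, Set.forall_mem_range.2 (I.longRunReward_le μ)⟩

theorem policyOpt_le : I.policyOpt μ ≤ I.jointStationary ⬝ᵥ I.maxReward :=
  (I.isLUB_policyOpt μ).2 (Set.forall_mem_range.2 (I.longRunReward_le μ))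

variable {μ π} in
theorem le_policyOpt_of_tendsto {φ : ℕ → ℕ} {f : ℕ → (Fin n → Bool) → ℝ} {c : ℝ}
    (hφ : Tendsto φ atTop atTop) (hc : Tendsto (fun m => μ.1 ⬝ᵥ f m / φ m) atTop (𝓝 c))
    (hf : ∀ m, f m ≤ I.totalReward π (φ m) []) : c ≤ I.policyOpt μ := by
  have hfπ (m : ℕ) : μ.1 ⬝ᵥ f m / φ m ≤ I.averageReward μ π (φ m) :=
    div_le_div_of_nonneg_right (dotProduct_le_dotProduct_of_nonneg_left (hf m) μ.2.1)
      (φ m).cast_nonneg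
  exact (le_limsup_of_tendsto_le_comp hφ hc (.of_forall hfπ)
    (I.isBoundedUnder_averageReward μ π)).trans ((I.isLUB_policyOpt μ).1 ⟨π, rfl⟩)

theorem jointStationary_dotProduct_reward_le_policyOpt (a : Option (Fin n)) :
    I.jointStationary ⬝ᵥ I.reward a ≤ I.policyOpt μ :=
  I.le_policyOpt_of_tendsto tendsto_id
    (I.tendsto_cesaro_dotProduct_pow_mulVec μ tendsto_id (I.reward a))
    fun T => (I.totalReward_deterministic_const a T []).ge

theorem policyOpt_pos {i : Fin n} (hi : 0 < I.r i) : 0 < I.policyOpt μ := by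
  refine lt_of_lt_of_le ?_ (I.jointStationary_dotProduct_reward_le_policyOpt μ (some i))
  refine Finset.sum_pos' (fun s _ => mul_nonneg (I.jointStationary_pos s).le
    (I.reward_nonneg _ s)) ⟨fun _ => true, Finset.mem_univ _, ?_⟩
  exact mul_pos (I.jointStationary_pos _) (by simpa [reward] using hi)

end LongRunReward

section BlockPolicy

variable (I : FeedbackMAB n)

/-- The state of each arm as seen in the first `n` of the last `k` steps, if these steps began with
a play of each arm in turn. Records are listed from the latest to the earliest, so the play of arm
`i` has the index `k - 1 - i`. -/
def observed (k : ℕ) (h : List (Record n)) (i : Fin n) : Bool :=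
  decide (h[k - 1 - i]? = some (some (i, true)))

/-- Each of the arms played so far in the exploration phase, when `k` steps of the block have
passed, was observed in its state in `s`. -/
def Informed (k : ℕ) (h : List (Record n)) (s : Fin n → Bool) : Prop :=
  ∀ i : Fin n, i.val < k → observed k h i = s i

/-- Explore, then exploit: in each block of `L` steps, play all arms in turn and then, to the end
of the block, an action that is best for the state observed in this way. -/
noncomputable def blockRule (L : ℕ) (h : List (Record n)) : Option (Fin n) :=
  if hk : h.length % L < n then some ⟨h.length % L, hk⟩
  else I.bestAction (observed (h.length % L) h)

theorem informed_zero (h : List (Record n)) (s : Fin n → Bool) : Informed 0 h s :=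
  fun i hi => absurd hi i.val.not_lt_zero

variable {I} {L k : ℕ} {h : List (Record n)} {s : Fin n → Bool}

theorem Informed.observed_eq (hs : Informed k h s) (hnk : n ≤ k) : observed k h = s :=
  funext fun i => hs i (i.2.trans_le hnk)

theorem Informed.cons (hs : Informed k h s) (hk : h.length % L = k) :
    Informed (k + 1) (record (I.blockRule L h) s :: h) s := by
  intro i hi
  rcases Nat.lt_succ_iff_lt_or_eq.1 hi with hik | hik
  · rw [← hs i hik, observed, observed, show k + 1 - 1 - i.val = k - 1 - i + 1 by omega,
      List.getElem?_cons_succ]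
  · have hkn : h.length % L < n := hk ▸ hik ▸ i.2
    have hplay : I.blockRule L h = some i := by
      rw [blockRule, dif_pos hkn]
      exact congrArg some (Fin.ext (hk.trans hik.symm))
    rw [observed, hplay, show k + 1 - 1 - i.val = 0 by omega, List.getElem?_cons_zero]
    simp [record]

theorem Informed.le_reward_blockRule (hs : Informed k h s) (hk : h.length % L = k) :
    ((max (k + 1) n : ℕ) - (max k n : ℕ)) * I.maxReward s ≤ I.reward (I.blockRule L h) s := by
  rcases lt_or_ge k n with hkn | hnk
  · rw [max_eq_right hkn.le, max_eq_right (Nat.succ_le_of_lt hkn), sub_self, zero_mul]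
    exact I.reward_nonneg _ s
  · rw [max_eq_left hnk, max_eq_left (hnk.trans k.le_succ), Nat.cast_succ, add_sub_cancel_left,
      one_mul, blockRule, dif_neg (by omega), hk, hs.observed_eq hnk, reward_bestAction]

/-- The probability that the joint state changes in the next step. -/
noncomputable def changeProb (I : FeedbackMAB n) (s : Fin n → Bool) : ℝ :=
  1 - I.jointMatrix s s

theorem changeProb_nonneg (s : Fin n → Bool) : 0 ≤ I.changeProb s :=
  sub_nonneg.2 (le_one_of_mem_rowStochastic I.jointMatrix_mem_rowStochastic)

open Classical in
/-- A lower bound for the reward still to come in a block of length `L` after its first `k` steps,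
on condition that the state `s` persists. -/
noncomputable def exploitValue (I : FeedbackMAB n) (L k : ℕ) (h : List (Record n))
    (s : Fin n → Bool) : ℝ :=
  if Informed k h s then ((L : ℝ) - (max k n : ℕ)) * I.maxReward s else 0

open Classical in
theorem exploitValue_nonneg (hnL : n ≤ L) (hkL : k ≤ L) : 0 ≤ I.exploitValue L k h := fun s =>
  ite_nonneg (mul_nonneg (sub_nonneg.2 (Nat.cast_le.2 (max_le hkL hnL))) (I.maxReward_nonneg s))
    le_rfl

theorem exploitValue_self_nonpos : I.exploitValue L L h ≤ 0 := by
  intro s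
  rw [exploitValue]
  split_ifs
  · exact mul_nonpos_of_nonpos_of_nonneg (sub_nonpos.2 (Nat.cast_le.2 (le_max_left L n)))
      (I.maxReward_nonneg s)
  · exact le_rfl

theorem exploitValue_le (hnL : n ≤ L) (hkL : k < L) (hk : h.length % L = k) (s : Fin n → Bool) :
    I.exploitValue L k h s ≤ I.reward (I.blockRule L h) s +
      (I.jointMatrix *ᵥ I.exploitValue L (k + 1) (record (I.blockRule L h) s :: h)) s +
      L * (I.changeProb s * I.maxReward s) := by
  set h' := record (I.blockRule L h) s :: h
  have hnext (s' : Fin n → Bool) : 0 ≤ I.jointMatrix s s' * I.exploitValue L (k + 1) h' s' :=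
    mul_nonneg (I.jointMatrix_mem_rowStochastic.1 s s') (exploitValue_nonneg hnL hkL s')
  have hloss : 0 ≤ I.changeProb s * I.maxReward s :=
    mul_nonneg (changeProb_nonneg s) (I.maxReward_nonneg s)
  by_cases hs : Informed k h s
  · have hstay : I.jointMatrix s s * I.exploitValue L (k + 1) h' s ≤
        (I.jointMatrix *ᵥ I.exploitValue L (k + 1) h') s :=
      Finset.single_le_sum (fun s' _ => hnext s') (Finset.mem_univ s)
    have hreward := hs.le_reward_blockRule (I := I) hk
    rw [exploitValue, if_pos (hs.cons hk),
      show I.jointMatrix s s = 1 - I.changeProb s by rw [changeProb, sub_sub_cancel]] at hstay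
    rw [exploitValue, if_pos hs]
    have hmax : 0 ≤ ((max (k + 1) n : ℕ) : ℝ) * (I.changeProb s * I.maxReward s) :=
      mul_nonneg (Nat.cast_nonneg _) hloss
    linear_combination hreward + hstay + hmax
  · rw [exploitValue, if_neg hs]
    exact add_nonneg (add_nonneg (I.reward_nonneg _ s) (Finset.sum_nonneg fun s' _ => hnext s'))
      (mul_nonneg L.cast_nonneg hloss)

theorem le_totalReward_blockRule (hnL : n ≤ L) {T : ℕ} {W : (Fin n → Bool) → ℝ}
    (hW : ∀ h : List (Record n), h.length ≡ 0 [MOD L] →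
      W ≤ I.totalReward (deterministic (I.blockRule L)) T h)
    {R k : ℕ} (hkR : k + R = L) {h : List (Record n)} (hk : h.length ≡ k [MOD L]) :
    I.exploitValue L k h -
        (L : ℝ) • ∑ j ∈ Finset.range R, I.jointMatrix ^ j *ᵥ (I.changeProb * I.maxReward) +
        I.jointMatrix ^ R *ᵥ W ≤
      I.totalReward (deterministic (I.blockRule L)) (R + T) h := by
  induction R generalizing k h with
  | zero =>
    obtain rfl : k = L := hkR
    have hh : h.length ≡ 0 [MOD k] := hk.trans (Nat.mod_self k)
    simpa using add_le_add exploitValue_self_nonpos (hW h hh)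
  | succ R ih =>
    intro s
    have hkL : k < L := by omega
    have hstep := exploitValue_le (I := I) hnL hkL (Eq.trans hk (Nat.mod_eq_of_lt hkL)) s
    have hrest := mulVec_mono_of_mem_rowStochastic I.jointMatrix_mem_rowStochastic
      (ih (by omega) (h := record (I.blockRule L h) s :: h) (hk.add_right 1)) s
    simp only [mulVec_add, mulVec_sub, mulVec_smul, mulVec_mulVec, ← pow_succ', Pi.add_apply,
      Pi.sub_apply, Pi.smul_apply, smul_eq_mul] at hrest
    rw [Nat.add_right_comm, totalReward_deterministic_succ, sum_range_succ_pow_mulVec]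
    simp only [Pi.add_apply, Pi.sub_apply, Pi.smul_apply, Pi.mul_apply, smul_eq_mul]
    linear_combination hstep + hrest

/-- A lower bound for the expected reward of `blockRule` in a block of length `L`, as a function of
the joint state at the beginning of the block. -/
noncomputable def blockBound (I : FeedbackMAB n) (L : ℕ) : (Fin n → Bool) → ℝ :=
  ((L : ℝ) - n) • I.maxReward -
    (L : ℝ) • ∑ j ∈ Finset.range L, I.jointMatrix ^ j *ᵥ (I.changeProb * I.maxReward)

theorem sum_blockBound_le (hnL : n ≤ L) (m : ℕ) (hh : h.length ≡ 0 [MOD L]) :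
    ∑ j ∈ Finset.range m, I.jointMatrix ^ (j * L) *ᵥ I.blockBound L ≤
      I.totalReward (deterministic (I.blockRule L)) (m * L) h := by
  induction m generalizing h with
  | zero => exact (zero_mul L).symm ▸ le_rfl
  | succ m ih =>
    have hvalue : I.exploitValue L 0 h = ((L : ℝ) - n) • I.maxReward := by
      ext s
      simp [exploitValue, informed_zero]
    have hblock := le_totalReward_blockRule hnL (fun h' => ih) (zero_add L) hh
    rw [hvalue, ← blockBound] at hblock
    rw [Nat.succ_mul, Nat.add_comm (m * L)]
    simpa only [pow_mul', sum_range_succ_pow_mulVec, ← mulVec_mulVec, mulVec_sum] using hblock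

theorem jointStationary_dotProduct_blockBound (L : ℕ) :
    I.jointStationary ⬝ᵥ I.blockBound L = (L - n) * (I.jointStationary ⬝ᵥ I.maxReward) -
      L * (L * (I.jointStationary ⬝ᵥ (I.changeProb * I.maxReward))) := by
  simp only [blockBound, dotProduct_sub, dotProduct_smul, dotProduct_sum,
    jointStationary_dotProduct_pow_mulVec, Finset.sum_const, Finset.card_range, nsmul_eq_mul,
    smul_eq_mul]

theorem le_policyOpt (μ : stdSimplex ℝ (Fin n → Bool)) (hnL : n ≤ L) (hL : 0 < L) :
    (1 - n / L) * (I.jointStationary ⬝ᵥ I.maxReward) -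
      L * (I.jointStationary ⬝ᵥ (I.changeProb * I.maxReward)) ≤ I.policyOpt μ := by
  have hblocks : Tendsto (fun m => m * L) atTop atTop := tendsto_id.atTop_mul_const' hL
  refine I.le_policyOpt_of_tendsto hblocks ?_ fun m => sum_blockBound_le hnL m rfl
  have hlim := (I.tendsto_cesaro_dotProduct_pow_mulVec μ hblocks (I.blockBound L)).div_const (L : ℝ)
  have hL' : (L : ℝ) ≠ 0 := by positivity
  convert hlim using 2 with m
  · rw [Nat.cast_mul, div_div]
  · rw [jointStationary_dotProduct_blockBound]
    field_simp

end BlockPolicy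

section StationaryMeans

variable (I : FeedbackMAB n)

theorem maxReward_eq_of_forall_r_eq {ρ : ℝ} (hr : ∀ i, I.r i = ρ) (s : Fin n → Bool) :
    I.maxReward s = ρ * (1 - ∏ i, if s i = false then 1 else 0) := by
  rw [Finset.prod_ite_zero, Finset.prod_const_one]
  by_cases hs : ∃ i, s i = true
  · obtain ⟨i, hi⟩ := hs
    rw [if_neg (by simpa using ⟨i, hi⟩), sub_zero, mul_one]
    refine le_antisymm (ciSup_le fun a => ?_) ?_
    · rcases a with _ | j
      · exact hr i ▸ I.r_nonneg i
      · simp only [reward, hr]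
        split_ifs
        exacts [le_rfl, hr i ▸ I.r_nonneg i]
    · simpa [reward, hi, hr] using I.reward_le_maxReward (some i) s
  · rw [if_pos (by simpa using hs), sub_self, mul_zero]
    refine le_antisymm (ciSup_le fun a => ?_) (I.maxReward_nonneg s)
    rcases a with _ | j
    · exact le_rfl
    · exact (if_neg fun hj => hs ⟨j, hj⟩).le

theorem jointStationary_dotProduct_maxReward {ρ : ℝ} (hr : ∀ i, I.r i = ρ) :
    I.jointStationary ⬝ᵥ I.maxReward = ρ * (1 - ∏ i, I.stationary i false) := by
  have hprod := I.jointStationary_dotProduct_prod fun _ b => if b = false then 1 else 0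
  have hmax : I.maxReward = ρ • (1 - fun s => ∏ i, if s i = false then 1 else 0) :=
    funext (I.maxReward_eq_of_forall_r_eq hr)
  rw [hmax, dotProduct_smul, dotProduct_sub, dotProduct_one, I.jointStationary_mem_stdSimplex.2,
    hprod, smul_eq_mul]
  simp [dotProduct]

theorem jointStationary_dotProduct_changeProb_le : I.jointStationary ⬝ᵥ I.changeProb ≤
    ∑ i, 2 * I.α i * I.β i / (I.α i + I.β i) := by
  have hstay (i : Fin n) : I.stationary i ⬝ᵥ (fun b => I.transMatrix i b b) =
      1 - 2 * I.α i * I.β i / (I.α i + I.β i) := by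
    have hαβ := (I.α_add_β_pos i).ne'
    simp only [dotProduct, Fintype.sum_bool, stationary, transMatrix, of_apply]
    field_simp
    ring
  have hprod := I.jointStationary_dotProduct_prod fun i b => I.transMatrix i b b
  have hchange : I.changeProb = 1 - fun s => ∏ i, I.transMatrix i (s i) (s i) := rfl
  rw [hchange, dotProduct_sub, dotProduct_one, I.jointStationary_mem_stdSimplex.2, hprod,
    sub_le_comm, Finset.prod_congr rfl fun i _ => hstay i]
  refine one_sub_sum_le_prod_one_sub _ (fun i _ => ?_) fun i _ => ?_
  · have hα := I.α_pos i
    have hβ := I.β_pos i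
    positivity
  · rw [div_le_one (I.α_add_β_pos i)]
    nlinarith [I.α_pos i, I.β_pos i, I.bursty i]

end StationaryMeans

section Whittle

variable (I : FeedbackMAB n)

theorem le_of_mem_whittleValues {R w : ℝ} (hr : ∀ i, I.r i ≤ R) (hw : w ∈ I.whittleValues) :
    w ≤ R := by
  obtain ⟨x, hx, rfl⟩ := hw
  have hx0 (i : Fin n) (s : Bool) : 0 ≤ ∑' t, x i s t := tsum_nonneg (hx.nonneg i s)
  calc I.whittleObjective x = ∑ i, I.r i * ∑' t, x i true t := by
        simp only [whittleObjective, tsum_mul_left]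
    _ ≤ ∑ i, R * ∑ s, ∑' t, x i s t := Finset.sum_le_sum fun i _ =>
        mul_le_mul (hr i) (Finset.single_le_sum (fun s _ => hx0 i s) (Finset.mem_univ true))
          (hx0 i true) ((I.r_nonneg i).trans (hr i))
    _ = R := by rw [← Finset.mul_sum, hx.plays, mul_one]

/-- The LP solution that plays arm `i` with the frequency `w i`, again at once if it was good and
after `t i` steps if it was bad. -/
noncomputable def thresholdSolution (w : Fin n → ℝ) (t : Fin n → ℕ+) (i : Fin n) :
    Bool → ℕ+ → ℝ
  | true => Pi.single 1 (w i * (I.v i (t i) / (I.v i (t i) + I.β i)))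
  | false => Pi.single (t i) (w i * (I.β i / (I.v i (t i) + I.β i)))

theorem whittleFeasible_thresholdSolution {w : Fin n → ℝ} (hw : w ∈ stdSimplex ℝ (Fin n))
    {t : Fin n → ℕ+}
    (ht : ∀ i, w i * (I.v i (t i) + t i * I.β i) ≤ I.v i (t i) + I.β i) :
    I.WhittleFeasible (I.thresholdSolution w t) := by
  have hv (i : Fin n) : 0 < I.v i (t i) := I.v_pos i (t i).pos
  have hvβ (i : Fin n) : 0 < I.v i (t i) + I.β i := add_pos (hv i) (I.β_pos i)
  constructor
  · rintro i (_ | _)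
    · exact (Pi.single_nonneg (α := fun _ => ℝ)).2
        (mul_nonneg (hw.1 i) (div_pos (I.β_pos i) (hvβ i)).le)
    · exact (Pi.single_nonneg (α := fun _ => ℝ)).2
        (mul_nonneg (hw.1 i) (div_pos (hv i) (hvβ i)).le)
  · rintro i (_ | _)
    · exact (hasSum_mul_pi_single _ _ _).summable
    · exact (hasSum_mul_pi_single _ _ _).summable
  · rw [← hw.2]
    refine Finset.sum_congr rfl fun i _ => ?_
    simp only [Fintype.sum_bool, thresholdSolution, tsum_pi_single]
    rw [← mul_add, ← add_div, div_self (hvβ i).ne', mul_one]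
  · intro i
    simp only [Fintype.sum_bool, thresholdSolution, tsum_mul_pi_single, PNat.one_coe, Nat.cast_one]
    calc 1 * (w i * (I.v i (t i) / (I.v i (t i) + I.β i))) +
          t i * (w i * (I.β i / (I.v i (t i) + I.β i)))
        = w i * (I.v i (t i) + t i * I.β i) / (I.v i (t i) + I.β i) := by ring
      _ ≤ 1 := (div_le_one (hvβ i)).2 (ht i)
  · intro i
    simp only [mul_comm (I.thresholdSolution w t i _ _)]
    simp only [thresholdSolution, tsum_mul_pi_single, PNat.one_coe, u_one]
    ring

theorem whittleObjective_thresholdSolution (w : Fin n → ℝ) (t : Fin n → ℕ+) :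
    I.whittleObjective (I.thresholdSolution w t) =
      ∑ i, w i * (I.r i * (I.v i (t i) / (I.v i (t i) + I.β i))) := by
  simp only [whittleObjective, thresholdSolution, tsum_mul_pi_single, mul_left_comm]

end Whittle

section IID

variable {β : ℝ} (hn : 2 ≤ n) (hβ : 0 < β) (h : (n : ℝ) * β < n - 1)

include hn in
theorem cast_sub_one_pos : (0 : ℝ) < n - 1 :=
  sub_pos.2 (by exact_mod_cast hn)

theorem iid_α_add_β (i : Fin n) :
    (iid n β hn hβ h).α i + (iid n β hn hβ h).β i = n * β / (n - 1) := by
  have hn' := (cast_sub_one_pos hn).ne'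
  simp only [iid]
  field_simp
  ring

theorem iid_stationary_false (i : Fin n) : (iid n β hn hβ h).stationary i false = 1 - 1 / n := by
  have hn' := (cast_sub_one_pos hn).ne'
  have hn0 : (n : ℝ) ≠ 0 := by positivity
  rw [stationary, iid_α_add_β]
  simp only [iid]
  field_simp

theorem iid_jointStationary_dotProduct_maxReward :
    (iid n β hn hβ h).jointStationary ⬝ᵥ (iid n β hn hβ h).maxReward =
      1 - (1 - 1 / (n : ℝ)) ^ n := by
  rw [jointStationary_dotProduct_maxReward _ (ρ := 1) fun _ => rfl, one_mul,
    Finset.prod_congr rfl fun i _ => iid_stationary_false hn hβ h i, Finset.prod_const,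
    Finset.card_univ, Fintype.card_fin]

theorem iid_maxReward_le_one : (iid n β hn hβ h).maxReward ≤ 1 := fun s => by
  rw [maxReward_eq_of_forall_r_eq _ (ρ := 1) fun _ => rfl, one_mul]
  exact sub_le_self _ (Finset.prod_nonneg fun i _ => ite_nonneg zero_le_one le_rfl)

theorem iid_jointStationary_dotProduct_changeProb_mul_maxReward_le :
    (iid n β hn hβ h).jointStationary ⬝ᵥ
      ((iid n β hn hβ h).changeProb * (iid n β hn hβ h).maxReward) ≤ 2 * β := by
  have hn' := (cast_sub_one_pos hn).ne'
  have hn0 : (n : ℝ) ≠ 0 := by positivity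
  set I := iid n β hn hβ h
  calc I.jointStationary ⬝ᵥ (I.changeProb * I.maxReward)
      ≤ I.jointStationary ⬝ᵥ I.changeProb :=
        dotProduct_le_dotProduct_of_nonneg_left
          (fun s => mul_le_of_le_one_right (changeProb_nonneg s) (iid_maxReward_le_one hn hβ h s))
          I.jointStationary_mem_stdSimplex.1
    _ ≤ ∑ i, 2 * I.α i * I.β i / (I.α i + I.β i) := I.jointStationary_dotProduct_changeProb_le
    _ = ∑ _ : Fin n, 2 * β / n := Finset.sum_congr rfl fun i _ => by
        rw [iid_α_add_β]
        simp only [I, iid]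
        field_simp
    _ = 2 * β := by
        rw [Finset.sum_const, Finset.card_univ, Fintype.card_fin, nsmul_eq_mul]
        field_simp

theorem mul_le_mul_iid_v (i : Fin n) (t : ℕ) :
    t * β ≤ (n - 1) * ((iid n β hn hβ h).v i t * (1 + t * (n * β / (n - 1)))) := by
  have hn' := cast_sub_one_pos hn
  have hv := (iid n β hn hβ h).div_one_add_le_v i t
  rw [iid_α_add_β, div_le_iff₀ (by positivity)] at hv
  calc t * β = (n - 1) * (t * (iid n β hn hβ h).α i) := by
        simp only [iid]
        field_simp
    _ ≤ _ := mul_le_mul_of_nonneg_left hv hn'.le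

theorem iid_div_mem_whittleValues (i : Fin n) {t : ℕ+} (ht : t ^ 2 * (n * β / (n - 1)) ≤ n) :
    (iid n β hn hβ h).v i t / ((iid n β hn hβ h).v i t + β) ∈
      (iid n β hn hβ h).whittleValues := by
  have hn' := cast_sub_one_pos hn
  have hn0 : (0 : ℝ) < n := by linarith
  have hv := mul_le_mul_iid_v hn hβ h i t
  set I := iid n β hn hβ h
  have hfreq : (fun _ : Fin n => 1 / (n : ℝ)) ∈ stdSimplex ℝ (Fin n) :=
    ⟨fun _ => by positivity, by simp [hn0.ne']⟩
  have htime : 1 / n * (I.v i t + t * β) ≤ I.v i t + β := by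
    have hwait : (t - n) * β * (1 + t * (n * β / (n - 1))) ≤ t * β := by
      have hcross : 0 ≤ n * β * (t * (n * β / (n - 1))) := by positivity
      linear_combination β * ht + hcross
    rw [one_div, inv_mul_le_iff₀ hn0]
    refine le_of_mul_le_mul_right ?_ (show 0 < 1 + t * (n * β / (n - 1)) by positivity)
    linear_combination hv + hwait
  refine ⟨_, I.whittleFeasible_thresholdSolution hfreq (t := fun _ => t) fun _ => htime, ?_⟩
  calc _ = ∑ _ : Fin n, 1 / n * (1 * (I.v i t / (I.v i t + β))) :=
        I.whittleObjective_thresholdSolution _ _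
    _ = I.v i t / (I.v i t + β) := by rw [← Finset.sum_mul, hfreq.2, one_mul, one_mul]

theorem le_mul_iid_v (i : Fin n) {t : ℕ+} (ht : n ≤ 4 * (t : ℝ) ^ 2 * (n * β / (n - 1))) :
    β ≤ (2 * √(n * β) + n * β) * (iid n β hn hβ h).v i t := by
  have hn' := cast_sub_one_pos hn
  have ht0 : (0 : ℝ) < t := by exact_mod_cast t.pos
  have hv0 := (iid n β hn hβ h).v_pos i t.pos
  have hroot : n - 1 ≤ 2 * t * √(n * β) := by
    refine le_of_sq_le_sq ?_ (by positivity)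
    rw [mul_pow, Real.sq_sqrt (by positivity)]
    rw [mul_div_assoc', le_div_iff₀ hn'] at ht
    linear_combination ht + hn'
  refine le_of_mul_le_mul_left ?_ ht0
  calc t * β ≤ (n - 1) * ((iid n β hn hβ h).v i t * (1 + t * (n * β / (n - 1)))) :=
        mul_le_mul_iid_v hn hβ h i t
    _ = (n - 1 + t * (n * β)) * (iid n β hn hβ h).v i t := by field_simp
    _ ≤ (2 * t * √(n * β) + t * (n * β)) * (iid n β hn hβ h).v i t := by gcongr
    _ = t * ((2 * √(n * β) + n * β) * (iid n β hn hβ h).v i t) := by ring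

theorem exists_iid_whittleValue :
    ∃ w ∈ (iid n β hn hβ h).whittleValues, 1 - 3 * √(n * β) ≤ w := by
  have hn' := cast_sub_one_pos hn
  have hθ : 0 < n * β / (n - 1) := by positivity
  have hθn : 1 ≤ n / (n * β / (n - 1)) := by
    rw [one_le_div hθ]
    linarith [(div_lt_one hn').2 h]
  obtain ⟨t, htn, hnt⟩ := exists_pnat_sq_le_le_four_mul_sq hθn
  rw [le_div_iff₀ hθ] at htn
  rw [div_le_iff₀ hθ] at hnt
  let i : Fin n := ⟨0, by omega⟩
  have hv0 := (iid n β hn hβ h).v_pos i t.pos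
  have hβv := le_mul_iid_v hn hβ h i hnt
  refine ⟨_, iid_div_mem_whittleValues hn hβ h i htn, ?_⟩
  set v := (iid n β hn hβ h).v i t
  rcases le_or_gt √(n * β) 1 with hq | hq
  · have hroot : n * β ≤ √(n * β) := by
      calc n * β = √(n * β) * √(n * β) := (Real.mul_self_sqrt (by positivity)).symm
        _ ≤ √(n * β) := mul_le_of_le_one_left (Real.sqrt_nonneg _) hq
    have hβv' : β ≤ 3 * √(n * β) * v :=
      hβv.trans (mul_le_mul_of_nonneg_right (by linarith) hv0.le)
    rw [le_div_iff₀ (by positivity)]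
    have hrootβ : 0 ≤ √(n * β) * β := by positivity
    linear_combination hβv' + 3 * hrootβ
  · have hratio : 0 ≤ v / (v + β) := by positivity
    linarith

theorem iid_isLUB_whittleOpt :
    IsLUB (iid n β hn hβ h).whittleValues (iid n β hn hβ h).whittleOpt :=
  have ⟨w, hw, _⟩ := exists_iid_whittleValue hn hβ h
  isLUB_csSup ⟨w, hw⟩ ⟨1, fun _ => le_of_mem_whittleValues _ fun _ => le_rfl⟩

theorem iid_whittleOpt_le_one : (iid n β hn hβ h).whittleOpt ≤ 1 :=
  (iid_isLUB_whittleOpt hn hβ h).2 fun _ => le_of_mem_whittleValues _ fun _ => le_rfl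

theorem le_iid_whittleOpt : 1 - 3 * √(n * β) ≤ (iid n β hn hβ h).whittleOpt :=
  have ⟨_, hw, hle⟩ := exists_iid_whittleValue hn hβ h
  hle.trans ((iid_isLUB_whittleOpt hn hβ h).1 hw)

variable (μ : stdSimplex ℝ (Fin n → Bool))

theorem iid_longRunReward_le (π : Policy n) :
    (iid n β hn hβ h).longRunReward μ π ≤ 1 - (1 - 1 / (n : ℝ)) ^ n :=
  (longRunReward_le _ μ π).trans_eq (iid_jointStationary_dotProduct_maxReward hn hβ h)

theorem iid_policyOpt_le : (iid n β hn hβ h).policyOpt μ ≤ 1 - (1 - 1 / (n : ℝ)) ^ n :=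
  (policyOpt_le _ μ).trans_eq (iid_jointStationary_dotProduct_maxReward hn hβ h)

theorem iid_policyOpt_pos : 0 < (iid n β hn hβ h).policyOpt μ :=
  policyOpt_pos _ μ (i := ⟨0, by omega⟩) one_pos

theorem le_iid_policyOpt_of_block {K : ℕ} (hK : 0 < K) :
    1 - (1 - 1 / (n : ℝ)) ^ n - 1 / K - 2 * K * (n * β) ≤ (iid n β hn hβ h).policyOpt μ := by
  have hallBad : 0 ≤ (1 - 1 / (n : ℝ)) ^ n := pow_nonneg n.one_sub_one_div_cast_nonneg n
  have hblocks := le_policyOpt (I := iid n β hn hβ h) μ (Nat.le_mul_of_pos_right n hK)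
    (by positivity)
  have hloss := mul_le_mul_of_nonneg_left
    (iid_jointStationary_dotProduct_changeProb_mul_maxReward_le hn hβ h)
    (n * K).cast_nonneg (α := ℝ)
  have hexplore : (n : ℝ) / (n * K : ℕ) = 1 / K := by
    push_cast
    field_simp
  rw [iid_jointStationary_dotProduct_maxReward, hexplore] at hblocks
  have hexploreBad : 0 ≤ 1 / (K : ℝ) * (1 - 1 / (n : ℝ)) ^ n := by positivity
  push_cast at hloss hblocks
  linarith

theorem le_iid_policyOpt :
    1 - (1 - 1 / (n : ℝ)) ^ n - 5 * √(n * β) ≤ (iid n β hn hβ h).policyOpt μ := by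
  have hq0 : 0 < √(n * β) := by positivity
  have hq2 : n * β = √(n * β) ^ 2 := (Real.sq_sqrt (by positivity)).symm
  rcases le_or_gt √(n * β) 1 with hq | hq
  · have hK : 0 < ⌈1 / √(n * β)⌉₊ := Nat.ceil_pos.2 (by positivity)
    have hpolicy := le_iid_policyOpt_of_block hn hβ h μ hK
    have hexplore : 1 / (⌈1 / √(n * β)⌉₊ : ℝ) ≤ √(n * β) :=
      (one_div_le hq0 (by positivity)).1 (Nat.le_ceil _)
    have hchange : 2 * ⌈1 / √(n * β)⌉₊ * (n * β) ≤ 4 * √(n * β) := calc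
      2 * (⌈1 / √(n * β)⌉₊ : ℝ) * (n * β) ≤ 2 * (1 / √(n * β) + 1) * (n * β) := by
        gcongr
        exact (Nat.ceil_lt_add_one (by positivity)).le
      _ = 2 * √(n * β) + 2 * √(n * β) * √(n * β) := by
        generalize √(n * β) = q at *
        rw [hq2]
        field_simp
      _ ≤ 4 * √(n * β) := by nlinarith
    linarith
  · have hallBad : 0 ≤ (1 - 1 / (n : ℝ)) ^ n := pow_nonneg n.one_sub_one_div_cast_nonneg n
    linarith [iid_policyOpt_pos hn hβ h μ]

end IID

theorem tendsto_one_sub_one_sub_inv_pow :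
    Tendsto (fun n : ℕ => 1 - (1 - 1 / (n : ℝ)) ^ n) atTop (𝓝 (1 - 1 / Real.exp 1)) := by
  have h := (Real.tendsto_one_add_div_pow_exp (-1)).const_sub 1
  simpa only [neg_div, ← sub_eq_add_neg, Real.exp_neg, ← one_div] using h

theorem exists_forall_abs_iid_gap_sub_lt {ε : ℝ} (hε : 0 < ε) : ∃ N : ℕ, ∃ κ : ℝ, 0 < κ ∧
    ∀ (n : ℕ) (β : ℝ) (hn : 2 ≤ n) (hβ : 0 < β) (h : (n : ℝ) * β < n - 1)
      (μ : stdSimplex ℝ (Fin n → Bool)), N ≤ n → (n : ℝ) * β < κ →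
      |(iid n β hn hβ h).gap μ - Real.exp 1 / (Real.exp 1 - 1)| < ε := by
  have he : 1 < Real.exp 1 := Real.one_lt_exp_iff.2 one_pos
  have hlimit : Real.exp 1 / (Real.exp 1 - 1) = 1 / (1 - 1 / Real.exp 1) := by
    rw [one_sub_div (by positivity), one_div_div]
  have hdiv : ContinuousAt (fun p : ℝ × ℝ => p.1 / p.2) (1, 1 - 1 / Real.exp 1) :=
    continuousAt_fst.div continuousAt_snd (sub_pos.2 ((div_lt_one (by positivity)).2 he)).ne'
  obtain ⟨δ, hδ, hclose⟩ := Metric.continuousAt_iff.1 hdiv ε hε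
  obtain ⟨N, hN⟩ := Metric.tendsto_atTop.1 tendsto_one_sub_one_sub_inv_pow (δ / 2) (by positivity)
  refine ⟨N, (δ / 10) ^ 2, by positivity, fun n β hn hβ h μ hNn hκ => ?_⟩
  have hroot : √((n : ℝ) * β) < δ / 10 := (Real.sqrt_lt' (by positivity)).2 hκ
  have hmean := abs_lt.1 (hN n hNn)
  have hLP : |(iid n β hn hβ h).whittleOpt - 1| < δ :=
    abs_lt.2 ⟨by linarith [le_iid_whittleOpt hn hβ h],
      by linarith [iid_whittleOpt_le_one hn hβ h]⟩
  have hPOL : |(iid n β hn hβ h).policyOpt μ - (1 - 1 / Real.exp 1)| < δ :=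
    abs_lt.2 ⟨by linarith [le_iid_policyOpt hn hβ h μ],
      by linarith [iid_policyOpt_le hn hβ h μ]⟩
  rw [hlimit]
  exact hclose (x := ((iid n β hn hβ h).whittleOpt, (iid n β hn hβ h).policyOpt μ))
    (max_lt hLP hPOL)

end FeedbackMAB

theorem mainTheorem6 :
    -- the gap is arbitrarily close to `e / (e - 1)`, for all large `n` and all small `n β`
    (∀ ε : ℝ, 0 < ε → ∃ N : ℕ, ∃ κ : ℝ, 0 < κ ∧
      ∀ (n : ℕ) (β : ℝ) (hn : 2 ≤ n) (hβ : 0 < β) (h : (n : ℝ) * β < n - 1)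
        (μ : stdSimplex ℝ (Fin n → Bool)), N ≤ n → (n : ℝ) * β < κ →
        |(FeedbackMAB.iid n β hn hβ h).gap μ - Real.exp 1 / (Real.exp 1 - 1)| < ε) ∧
    -- the LP value is `1 - O(√(n β))`, and no policy gets more than `1 - (1 - 1 / n) ^ n`
    (∃ C : ℝ, 0 < C ∧
      ∀ (n : ℕ) (β : ℝ) (hn : 2 ≤ n) (hβ : 0 < β) (h : (n : ℝ) * β < n - 1),
        IsLUB (FeedbackMAB.iid n β hn hβ h).whittleValues
          (FeedbackMAB.iid n β hn hβ h).whittleOpt ∧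
        1 - C * √((n : ℝ) * β) ≤ (FeedbackMAB.iid n β hn hβ h).whittleOpt ∧
        (FeedbackMAB.iid n β hn hβ h).whittleOpt ≤ 1 ∧
        ∀ μ : stdSimplex ℝ (Fin n → Bool),
          IsLUB (Set.range ((FeedbackMAB.iid n β hn hβ h).longRunReward μ))
            ((FeedbackMAB.iid n β hn hβ h).policyOpt μ) ∧
          0 < (FeedbackMAB.iid n β hn hβ h).policyOpt μ ∧
          ∀ π : FeedbackMAB.Policy n,
            (FeedbackMAB.iid n β hn hβ h).longRunReward μ π ≤ 1 - (1 - 1 / (n : ℝ)) ^ n) ∧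
    Filter.Tendsto (fun n : ℕ => 1 - (1 - 1 / (n : ℝ)) ^ n) Filter.atTop
      (nhds (1 - 1 / Real.exp 1)) := by
  refine ⟨fun ε hε => FeedbackMAB.exists_forall_abs_iid_gap_sub_lt hε,
    ⟨3, by norm_num, fun n β hn hβ h => ?_⟩, FeedbackMAB.tendsto_one_sub_one_sub_inv_pow⟩
  refine ⟨FeedbackMAB.iid_isLUB_whittleOpt hn hβ h, FeedbackMAB.le_iid_whittleOpt hn hβ h,
    FeedbackMAB.iid_whittleOpt_le_one hn hβ h, fun μ => ?_⟩
  exact ⟨FeedbackMAB.isLUB_policyOpt _ μ, FeedbackMAB.iid_policyOpt_pos hn hβ h μ,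
    FeedbackMAB.iid_longRunReward_le hn hβ h μ⟩
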